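/- Let $d\ge 1$ and equip $\mathbb R^d$ with the Euclidean distance (or, more generally, with the $\ell_p$ distance for a fixed $p\in[1,\infty]$). For $V\subseteq\mathbb R^d$ and $r\ge 0$ let $G_r(V)$ be the graph with vertex set $V$ in which two distinct points are adjacent iff their distance is at most $r$, and for finite $V$ let $N_{k,r}(V)$ be the maximum number of vertices of $G_r(V)$ that can be properly colored with $k$ colors, i.e. the largest cardinality of a subset $W\subseteq V$ such that the subgraph induced by $W$ is $k$-colorable. For $\lambda>0$ let $\mathcal X_\lambda$ be a Poisson point process of intensity $\lambda$ in $\mathbb R^d$ and put, for $t>0$, $$F_{k,\lambda}(t)=N_{k,1}([0,t]^d\cap\mathcal X_\lambda),\qquad a_{k,\lambda}=\inf_{t>0}\frac{\mathbb E[F_{k,\lambda}(t)]}{\lambda t^d}.$$ For $n\in\mathbb N$ and $r>0$ let $H_{k,r}(n)=N_{k,r}(\mathcal I_n)$, where $\mathcal I_n$ is a collection of $n$ independent points uniformly distributed in the unit cube $[0,1]^d$. Then for every integer $k\ge 1$ and every real $\nu>0$ (all the expectations involved being well defined and finite), $$\lim_{n\to\infty}\frac{\mathbb E\big[H_{k,(\nu/n)^{1/d}}(n)\big]}{n}=a_{k,\nu}.$$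 -/

import Mathlib

open MeasureTheory ProbabilityTheory Filter Topology
open scoped ENNReal NNReal

namespace RandomGeometricGraph

/-- The graph `G_r(V)`: its vertices are the points of `V ⊆ ℝ^d`, and two distinct vertices are
adjacent iff their `ℓ_p` distance is at most `r` (`p = 2` is the Euclidean distance). -/
def geometricGraph (p : ℝ≥0∞) [Fact (1 ≤ p)] {d : ℕ} (r : ℝ) (V : Set (Fin d → ℝ)) :
    SimpleGraph V where
  Adj u v := u ≠ v ∧
    dist (WithLp.toLp p (u : Fin d → ℝ)) (WithLp.toLp p (v : Fin d → ℝ)) ≤ r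
  symm := ⟨fun _ _ h => ⟨h.1.symm, by rw [dist_comm]; exact h.2⟩⟩
  loopless := ⟨fun _ h => h.1 rfl⟩

/-- The maximum number of vertices of `G` that can be properly coloured with `k` colours: the
largest cardinality of a finite set of vertices that induces a `k`-colourable subgraph. -/
noncomputable def maxColored {V : Type*} (G : SimpleGraph V) (k : ℕ) : ℕ :=
  sSup {m : ℕ | ∃ W : Finset V, (G.induce (W : Set V)).Colorable k ∧ W.card = m}

/-- The functional `N_{k,r}(V)`. -/
noncomputable def N (p : ℝ≥0∞) [Fact (1 ≤ p)] {d : ℕ} (k : ℕ) (r : ℝ)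
    (V : Set (Fin d → ℝ)) : ℕ :=
  maxColored (geometricGraph p r V) k

/-- `X` is a (homogeneous) Poisson point process of intensity `lam` in `ℝ^d`: a random locally
finite set of points such that the number of points in a bounded Borel set `B` is a Poisson random
variable with mean `lam * vol B`, and the numbers of points in pairwise disjoint bounded Borel
sets are independent. -/
structure IsPoissonProcess {Ω : Type*} [MeasurableSpace Ω] {d : ℕ} (lam : ℝ)
    (X : Ω → Set (Fin d → ℝ)) (P : Measure Ω) : Prop where
  locallyFinite : ∀ ω, ∀ B : Set (Fin d → ℝ), Bornology.IsBounded B → (X ω ∩ B).Finite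
  measurable_count : ∀ B : Set (Fin d → ℝ), MeasurableSet B → Bornology.IsBounded B →
    Measurable fun ω => (X ω ∩ B).ncard
  map_count : ∀ B : Set (Fin d → ℝ), MeasurableSet B → Bornology.IsBounded B →
    P.map (fun ω => (X ω ∩ B).ncard) = poissonMeasure (lam * volume.real B).toNNReal
  indep_count : ∀ (m : ℕ) (B : Fin m → Set (Fin d → ℝ)), (∀ i, MeasurableSet (B i)) →
    (∀ i, Bornology.IsBounded (B i)) → Pairwise (fun i j => Disjoint (B i) (B j)) →
    iIndepFun (fun i ω => (X ω ∩ B i).ncard) P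

/-- `U 0, …, U (n - 1)` are independent random points, each uniformly distributed in the unit cube
`[0, 1]^d`. -/
structure IsUniformSample {Ω : Type*} [MeasurableSpace Ω] {d n : ℕ}
    (U : Fin n → Ω → Fin d → ℝ) (P : Measure Ω) : Prop where
  measurable : ∀ i, Measurable (U i)
  uniform : ∀ i, pdf.IsUniform (U i) (Set.Icc 0 1) P volume
  indep : iIndepFun U P

/-- The random variable `F_{k,λ}(t) = N_{k,1}([0,t]^d ∩ X)`, for a point process `X` (which will
be a Poisson process of intensity `λ`). -/
noncomputable def F (p : ℝ≥0∞) [Fact (1 ≤ p)] {Ω : Type*} {d : ℕ} (k : ℕ)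
    (X : Ω → Set (Fin d → ℝ)) (t : ℝ) (ω : Ω) : ℝ :=
  N p k 1 (Set.Icc 0 (fun _ => t) ∩ X ω)

/-- The random variable `H_{k,r}(n) = N_{k,r}({U 0, …, U (n - 1)})`. -/
noncomputable def H (p : ℝ≥0∞) [Fact (1 ≤ p)] {Ω : Type*} {d n : ℕ} (k : ℕ) (r : ℝ)
    (U : Fin n → Ω → Fin d → ℝ) (ω : Ω) : ℝ :=
  N p k r (Set.range fun i => U i ω)

/-- The constant `a_{k,λ} = inf_{t > 0} E[F_{k,λ}(t)] / (λ t^d)`, computed from a Poisson process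
`X` of intensity `lam` (it depends only on the law of `X`). -/
noncomputable def a (p : ℝ≥0∞) [Fact (1 ≤ p)] {Ω : Type*} [MeasurableSpace Ω] {d : ℕ} (k : ℕ)
    (lam : ℝ) (X : Ω → Set (Fin d → ℝ)) (P : Measure Ω) : ℝ :=
  ⨅ t : Set.Ioi (0 : ℝ), (∫ ω, F p k X (t : ℝ) ω ∂P) / (lam * (t : ℝ) ^ d)

end RandomGeometricGraph

namespace RandomGeometricGraph

/-! Put `t = (n/ν)^(1/d)`. Scaling `[0,t]^d` to the unit cube turns the process of intensity `ν`
into one of intensity `ν t^d = n`, and the radius `1` into `t⁻¹ = (ν/n)^(1/d)`. In the unit cube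
this process is a Poisson(`n`) number of independent uniform points. Deleting a point lowers `N` by
at most `1`, so `E F(t)` and `E H(n)` differ by at most the mean absolute deviation of Poisson(`n`),
hence by at most `√n` (`abs_integral_F_sub_integral_H_le`), which is negligible after division by
`n`. On the other side `E F(t) / (ν t^d)` tends to its infimum, because `N` is subadditive over a
partition into cubes (`IsPoissonProcess.tendsto_integral_F_div`).

The comparison of laws is the technical core, since a Poisson process is known only through its
counts. As in Rényi's theorem, avoidance probabilities suffice (`HasVoidLaw.integral_N_eq`): after
rounding to a finite grid, the law of the set of occupied grid points is determined by them, and a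
fine enough rounding, with a slightly larger radius, leaves `N` unchanged. The same approximation
makes `N` measurable. Scaling, translation invariance and Poissonization thus reduce to computing
avoidance probabilities. -/

/-- The points of `W` can be coloured with the colours `0, …, k - 1` in such a way that distinct
points at `ℓ_p` distance at most `r` get different colours. -/
def ProperlyColorable (p : ℝ≥0∞) [Fact (1 ≤ p)] {d : ℕ} (k : ℕ) (r : ℝ)
    (W : Set (Fin d → ℝ)) : Prop :=
  ∃ c : (Fin d → ℝ) → ℕ, (∀ x ∈ W, c x < k) ∧ ∀ x ∈ W, ∀ y ∈ W, x ≠ y →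
    dist (WithLp.toLp p x) (WithLp.toLp p y) ≤ r → c x ≠ c y

/-! ### Deterministic properties of `N`: monotonicity, subadditivity, similarities. -/

section Deterministic

variable {p : ℝ≥0∞} [Fact (1 ≤ p)] {d k : ℕ} {r r' : ℝ} {V V' : Set (Fin d → ℝ)}

lemma ProperlyColorable.mono {W W' : Set (Fin d → ℝ)} (h : ProperlyColorable p k r W')
    (hW : W ⊆ W') : ProperlyColorable p k r W := by
  obtain ⟨c, hc, hc'⟩ := h
  exact ⟨c, fun x hx => hc x (hW hx), fun x hx y hy => hc' x (hW hx) y (hW hy)⟩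

lemma colorable_induce_iff (W : Finset V) :
    ((geometricGraph p r V).induce (W : Set V)).Colorable k ↔
      ProperlyColorable p k r (W.map (Function.Embedding.subtype _) : Set (Fin d → ℝ)) := by
  classical
  constructor
  · rintro ⟨C⟩
    refine ⟨fun x => if hx : ∃ h : x ∈ V, (⟨x, h⟩ : V) ∈ W then C ⟨⟨x, hx.1⟩, hx.2⟩ else 0, ?_, ?_⟩
    · intro x hx
      have hx' : ∃ h : x ∈ V, (⟨x, h⟩ : V) ∈ W := by simpa using hx
      simp only [dif_pos hx']
      exact (C _).2
    · intro x hx y hy hxy hd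
      have hx' : ∃ h : x ∈ V, (⟨x, h⟩ : V) ∈ W := by simpa using hx
      have hy' : ∃ h : y ∈ V, (⟨y, h⟩ : V) ∈ W := by simpa using hy
      simp only [dif_pos hx', dif_pos hy']
      intro h
      refine C.valid (v := ⟨⟨x, hx'.1⟩, hx'.2⟩) (w := ⟨⟨y, hy'.1⟩, hy'.2⟩) ?_ (Fin.ext h)
      exact ⟨fun h => hxy (congrArg Subtype.val h), hd⟩
  · rintro ⟨c, hc, hc'⟩
    have hm (v : (W : Set V)) :
        (v : Fin d → ℝ) ∈ (W.map (Function.Embedding.subtype _) : Set (Fin d → ℝ)) := by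
      obtain ⟨⟨v, hv⟩, hw⟩ := v
      simpa using ⟨hv, hw⟩
    refine ⟨SimpleGraph.Coloring.mk (fun v => ⟨c v, hc _ (hm v)⟩) ?_⟩
    intro v w hvw h
    obtain ⟨hne, hd⟩ : (geometricGraph p r V).Adj v w := hvw
    exact hc' _ (hm v) _ (hm w) (fun h => hne (Subtype.ext h)) hd (congrArg Fin.val h)

/-- Colourings now live on the ambient space rather than on subtypes, so that different `V` can be
compared. -/
lemma N_eq_sSup (p : ℝ≥0∞) [Fact (1 ≤ p)] (k : ℕ) (r : ℝ) (V : Set (Fin d → ℝ)) :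
    N p k r V = sSup {m : ℕ | ∃ W : Finset (Fin d → ℝ), (W : Set (Fin d → ℝ)) ⊆ V ∧
      ProperlyColorable p k r (W : Set (Fin d → ℝ)) ∧ W.card = m} := by
  classical
  unfold N maxColored
  congr 1
  ext m
  constructor
  · rintro ⟨W, hW, rfl⟩
    refine ⟨W.map (Function.Embedding.subtype _), ?_, (colorable_induce_iff W).1 hW, by simp⟩
    intro x hx
    obtain ⟨h, -⟩ : ∃ h : x ∈ V, (⟨x, h⟩ : V) ∈ W := by simpa using hx
    exact h
  · rintro ⟨W, hWV, hW, rfl⟩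
    have hmap : (W.subtype (· ∈ V)).map (Function.Embedding.subtype _) = W := by
      rw [Finset.subtype_map, Finset.filter_true_of_mem fun x hx => hWV hx]
    refine ⟨W.subtype (· ∈ V), ?_, ?_⟩
    · rw [colorable_induce_iff]
      exact hmap.symm ▸ hW
    · conv_rhs => rw [← hmap, Finset.card_map]

lemma bddAbove_card_properlyColorable (hV : V.Finite) :
    BddAbove {m : ℕ | ∃ W : Finset (Fin d → ℝ), (W : Set (Fin d → ℝ)) ⊆ V ∧
      ProperlyColorable p k r (W : Set (Fin d → ℝ)) ∧ W.card = m} := by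
  refine ⟨V.ncard, ?_⟩
  rintro m ⟨W, hWV, -, rfl⟩
  rw [← Set.ncard_coe_finset]
  exact Set.ncard_le_ncard hWV hV

lemma card_le_N (hV : V.Finite) {W : Finset (Fin d → ℝ)} (hWV : (W : Set (Fin d → ℝ)) ⊆ V)
    (hW : ProperlyColorable p k r (W : Set (Fin d → ℝ))) : W.card ≤ N p k r V := by
  rw [N_eq_sSup]
  exact le_csSup (bddAbove_card_properlyColorable hV) ⟨W, hWV, hW, rfl⟩

lemma exists_card_eq_N (p : ℝ≥0∞) [Fact (1 ≤ p)] (k : ℕ) (r : ℝ) (hV : V.Finite) :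
    ∃ W : Finset (Fin d → ℝ), (W : Set (Fin d → ℝ)) ⊆ V ∧
      ProperlyColorable p k r (W : Set (Fin d → ℝ)) ∧ W.card = N p k r V := by
  rw [N_eq_sSup]
  refine Nat.sSup_mem ?_ (bddAbove_card_properlyColorable hV)
  exact ⟨0, ∅, by simp, ⟨fun _ => 0, by simp, by simp⟩, rfl⟩

lemma N_le_ncard (hV : V.Finite) : N p k r V ≤ V.ncard := by
  obtain ⟨W, hWV, -, h⟩ := exists_card_eq_N p k r hV
  rw [← h, ← Set.ncard_coe_finset]
  exact Set.ncard_le_ncard hWV hV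

lemma N_mono (hV' : V'.Finite) (h : V ⊆ V') : N p k r V ≤ N p k r V' := by
  obtain ⟨W, hWV, hW, hc⟩ := exists_card_eq_N p k r (hV'.subset h)
  exact hc ▸ card_le_N hV' (hWV.trans h) hW

lemma N_union_le (hV : V.Finite) (hV' : V'.Finite) :
    N p k r (V ∪ V') ≤ N p k r V + N p k r V' := by
  classical
  obtain ⟨W, hWV, hW, hc⟩ := exists_card_eq_N p k r (hV.union hV')
  rw [← hc]
  have h1 : (W.filter (· ∈ V)).card ≤ N p k r V :=
    card_le_N hV (fun x hx => (Finset.mem_filter.1 hx).2)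
      (hW.mono fun x hx => (Finset.mem_filter.1 hx).1)
  have h2 : (W.filter (· ∉ V)).card ≤ N p k r V' :=
    card_le_N hV' (fun x hx => (hWV (Finset.mem_filter.1 hx).1).resolve_left
      (Finset.mem_filter.1 hx).2) (hW.mono fun x hx => (Finset.mem_filter.1 hx).1)
  rw [← Finset.card_filter_add_card_filter_not (s := W) (· ∈ V)]
  exact add_le_add h1 h2

lemma N_biUnion_le {ι : Type*} (s : Finset ι) (A : ι → Set (Fin d → ℝ))
    (hA : ∀ i ∈ s, (A i).Finite) :
    N p k r (⋃ i ∈ s, A i) ≤ ∑ i ∈ s, N p k r (A i) := by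
  classical
  induction s using Finset.induction_on with
  | empty =>
    have := N_le_ncard (p := p) (k := k) (r := r) (Set.finite_empty (α := Fin d → ℝ))
    simpa using this
  | insert i s hi ih =>
    rw [Finset.set_biUnion_insert, Finset.sum_insert hi]
    have hs : ∀ j ∈ s, (A j).Finite := fun j hj => hA j (Finset.mem_insert_of_mem hj)
    exact (N_union_le (hA i (Finset.mem_insert_self i s)) (s.finite_toSet.biUnion hs)).trans
      (Nat.add_le_add_left (ih hs) _)

lemma N_le_add_ncard_sdiff (hV' : V'.Finite) (h : V ⊆ V') :
    N p k r V' ≤ N p k r V + (V' \ V).ncard := by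
  conv_lhs => rw [← Set.union_sdiff_cancel h]
  exact (N_union_le (hV'.subset h) hV'.sdiff).trans (Nat.add_le_add_left (N_le_ncard hV'.sdiff) _)

/-- `f` need not be injective: one preimage is chosen for each point of an optimal subset of the
image, and coloured through `f`. -/
lemma N_image_le (hV : V.Finite) (f : (Fin d → ℝ) → (Fin d → ℝ))
    (hf : ∀ x ∈ V, ∀ y ∈ V, dist (WithLp.toLp p x) (WithLp.toLp p y) ≤ r →
      dist (WithLp.toLp p (f x)) (WithLp.toLp p (f y)) ≤ r') :
    N p k r' (f '' V) ≤ N p k r V := by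
  classical
  obtain ⟨W, hWV, ⟨c, hc, hc'⟩, hN⟩ := exists_card_eq_N p k r' (hV.image f)
  have hg : ∀ y ∈ W, Function.invFunOn f V y ∈ V ∧ f (Function.invFunOn f V y) = y := fun y hy =>
    Function.invFunOn_pos (hWV hy)
  have hinj : Set.InjOn (Function.invFunOn f V) W := fun y hy z hz h => by
    rw [← (hg y hy).2, ← (hg z hz).2, h]
  rw [← hN, ← Finset.card_image_of_injOn hinj]
  refine card_le_N hV ?_ ⟨fun x => c (f x), ?_, ?_⟩ <;> rw [Finset.coe_image]
  · rintro _ ⟨y, hy, rfl⟩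
    exact (hg y hy).1
  · rintro _ ⟨y, hy, rfl⟩
    simpa only [(hg y hy).2] using hc y hy
  · rintro _ ⟨y, hy, rfl⟩ _ ⟨z, hz, rfl⟩ hyz hd
    have hd' := hf _ (hg y hy).1 _ (hg z hz).1 hd
    simp only [(hg y hy).2, (hg z hz).2] at hd' ⊢
    exact hc' y hy z hz (fun h => hyz (congrArg _ h)) hd'

lemma le_N_image (hV : V.Finite) (f : (Fin d → ℝ) → (Fin d → ℝ)) (hinj : Set.InjOn f V)
    (hf : ∀ x ∈ V, ∀ y ∈ V, dist (WithLp.toLp p (f x)) (WithLp.toLp p (f y)) ≤ r' →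
      dist (WithLp.toLp p x) (WithLp.toLp p y) ≤ r) :
    N p k r V ≤ N p k r' (f '' V) := by
  classical
  obtain ⟨W, hWV, ⟨c, hc, hc'⟩, hN⟩ := exists_card_eq_N p k r hV
  have hinv : ∀ x ∈ W, Function.invFunOn f V (f x) = x := fun x hx =>
    hinj.leftInvOn_invFunOn (hWV hx)
  rw [← hN, ← Finset.card_image_of_injOn (hinj.mono hWV)]
  refine card_le_N (hV.image f) ?_ ⟨fun y => c (Function.invFunOn f V y), ?_, ?_⟩
  · rw [Finset.coe_image]
    exact Set.image_mono hWV
  · rw [Finset.coe_image]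
    rintro _ ⟨x, hx, rfl⟩
    simpa only [hinv x hx] using hc x hx
  · rw [Finset.coe_image]
    rintro _ ⟨x, hx, rfl⟩ _ ⟨y, hy, rfl⟩ hxy hd
    simp only [hinv x hx, hinv y hy]
    exact hc' x hx y hy (fun h => hxy (congrArg f h)) (hf x (hWV hx) y (hWV hy) hd)

lemma N_image_eq (hV : V.Finite) (f : (Fin d → ℝ) → (Fin d → ℝ)) (hinj : Set.InjOn f V)
    (hf : ∀ x ∈ V, ∀ y ∈ V, dist (WithLp.toLp p (f x)) (WithLp.toLp p (f y)) ≤ r' ↔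
      dist (WithLp.toLp p x) (WithLp.toLp p y) ≤ r) :
    N p k r' (f '' V) = N p k r V :=
  le_antisymm (N_image_le hV f fun x hx y hy => (hf x hx y hy).2)
    (le_N_image hV f hinj fun x hx y hy => (hf x hx y hy).1)

lemma N_image_sub_smul (hV : V.Finite) {s : ℝ} (hs : 0 < s) (z : Fin d → ℝ) :
    N p k s⁻¹ ((fun x => s⁻¹ • (x - z)) '' V) = N p k 1 V := by
  refine N_image_eq hV _ (fun x _ y _ h => ?_) fun x _ y _ => ?_
  · simpa using smul_right_injective _ (inv_pos.2 hs).ne' h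
  · rw [WithLp.toLp_smul, WithLp.toLp_smul, dist_smul₀, WithLp.toLp_sub, WithLp.toLp_sub,
      dist_sub_right, Real.norm_of_nonneg (inv_pos.2 hs).le]
    exact mul_le_iff_le_one_right (inv_pos.2 hs)

end Deterministic

/-! ### Stability of `N` under rounding to a grid. -/

section Rounding

variable {p : ℝ≥0∞} [Fact (1 ≤ p)] {d k : ℕ} {r : ℝ} {V : Set (Fin d → ℝ)}

/-- Perturbing a finite point set by a small amount `δ`, and enlarging the radius by `2 δ`, does
not change the geometric graph. -/
lemma eventually_N_image_eq (hV : V.Finite) {q : ℕ → (Fin d → ℝ) → (Fin d → ℝ)} {δ : ℕ → ℝ}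
    (hδ : Tendsto δ atTop (𝓝 0))
    (hq : ∀ M x, dist (WithLp.toLp p (q M x)) (WithLp.toLp p x) ≤ δ M) :
    ∀ᶠ M in atTop, N p k (r + 2 * δ M) (q M '' V) = N p k r V := by
  -- Rounding changes a distance by at most `2 δ`. The enlarged radius keeps every edge, including
  -- pairs at distance exactly `r`; a non-edge survives once its gap beyond `r` exceeds `4 δ`.
  have key : ∀ x y : Fin d → ℝ, ∀ᶠ M in atTop, (q M x = q M y → x = y) ∧
      (dist (WithLp.toLp p (q M x)) (WithLp.toLp p (q M y)) ≤ r + 2 * δ M ↔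
        dist (WithLp.toLp p x) (WithLp.toLp p y) ≤ r) := by
    intro x y
    have h1 : ∀ᶠ M in atTop, x ≠ y →
        2 * δ M < dist (WithLp.toLp p x) (WithLp.toLp p y) := by
      by_cases hxy : x = y
      · simp [hxy]
      · have hpos : 0 < dist (WithLp.toLp p x) (WithLp.toLp p y) :=
          dist_pos.2 fun h => hxy ((WithLp.toLp_injective p) h)
        have ht : Tendsto (fun M => 2 * δ M) atTop (𝓝 0) := by simpa using hδ.const_mul 2
        exact (ht.eventually_lt_const hpos).mono fun M h _ => h
    have h2 : ∀ᶠ M in atTop, ¬ dist (WithLp.toLp p x) (WithLp.toLp p y) ≤ r →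
        4 * δ M < dist (WithLp.toLp p x) (WithLp.toLp p y) - r := by
      by_cases hxy : dist (WithLp.toLp p x) (WithLp.toLp p y) ≤ r
      · simp [hxy]
      · have ht : Tendsto (fun M => 4 * δ M) atTop (𝓝 0) := by simpa using hδ.const_mul 4
        exact (ht.eventually_lt_const (sub_pos.2 (not_le.1 hxy))).mono fun M h _ => h
    filter_upwards [h1, h2] with M h1 h2
    have hx := hq M x
    have hy := hq M y
    have t1 := dist_triangle4 (WithLp.toLp p x) (WithLp.toLp p (q M x)) (WithLp.toLp p (q M y))
      (WithLp.toLp p y)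
    have t2 := dist_triangle4 (WithLp.toLp p (q M x)) (WithLp.toLp p x) (WithLp.toLp p y)
      (WithLp.toLp p (q M y))
    rw [dist_comm (WithLp.toLp p x) (WithLp.toLp p (q M x))] at t1
    rw [dist_comm (WithLp.toLp p y) (WithLp.toLp p (q M y))] at t2
    refine ⟨fun h => ?_, fun h => ?_, fun h => by linarith⟩
    · by_contra hne
      have := h1 hne
      rw [h, dist_self] at t1
      rw [h] at hx
      linarith
    · by_contra hne
      have := h2 hne
      linarith
  have hall : ∀ᶠ M in atTop, ∀ x ∈ V, ∀ y ∈ V, (q M x = q M y → x = y) ∧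
      (dist (WithLp.toLp p (q M x)) (WithLp.toLp p (q M y)) ≤ r + 2 * δ M ↔
        dist (WithLp.toLp p x) (WithLp.toLp p y) ≤ r) := by
    rw [hV.eventually_all]
    intro x _
    rw [hV.eventually_all]
    exact fun y _ => key x y
  filter_upwards [hall] with M hM
  exact N_image_eq hV _ (fun x hx y hy => (hM x hx y hy).1) fun x hx y hy => (hM x hx y hy).2

/-- Round the coordinates of a point down to multiples of `1 / (M + 1)`. -/
noncomputable def gridRound (M : ℕ) (x : Fin d → ℝ) : Fin d → ℝ :=
  fun i => (⌊(M + 1 : ℝ) * x i⌋ : ℝ) / (M + 1)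

lemma measurable_gridRound (M : ℕ) : Measurable (gridRound (d := d) M) := by
  refine measurable_pi_lambda _ fun i => ?_
  refine Measurable.div_const ?_ _
  exact measurable_from_top.comp (Int.measurable_floor.comp ((measurable_pi_apply i).const_mul _))

lemma finite_gridRound_image (M : ℕ) :
    (gridRound M '' (Set.Icc 0 1 : Set (Fin d → ℝ))).Finite := by
  refine (Set.Finite.pi' (t := fun _ : Fin d =>
    (fun n : ℤ => (n : ℝ) / (M + 1)) '' Set.Icc 0 (M + 1 : ℤ)) fun _ =>
      (Set.finite_Icc _ _).image _).subset ?_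
  rintro _ ⟨x, hx, rfl⟩ i
  have h0 : 0 ≤ x i := hx.1 i
  have h1 : x i ≤ 1 := hx.2 i
  have hM : (0 : ℝ) < M + 1 := by positivity
  refine ⟨⌊(M + 1 : ℝ) * x i⌋, ⟨Int.floor_nonneg.2 (by positivity), ?_⟩, rfl⟩
  have : (⌊(M + 1 : ℝ) * x i⌋ : ℝ) ≤ M + 1 :=
    (Int.floor_le _).trans (mul_le_of_le_one_right hM.le h1)
  exact_mod_cast this

/-- Each coordinate moves by at most `1 / (M + 1)`; `C` is a Lipschitz constant of the identity from
the sup norm to the `ℓ_p` norm. -/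
lemma dist_gridRound_le (p : ℝ≥0∞) [Fact (1 ≤ p)] (d : ℕ) :
    ∃ C : ℝ, ∀ (M : ℕ) (x : Fin d → ℝ),
      dist (WithLp.toLp p (gridRound M x)) (WithLp.toLp p x) ≤ C / (M + 1) := by
  have hL := PiLp.lipschitzWith_toLp p (fun _ : Fin d => ℝ)
  set K : ℝ≥0 := (Fintype.card (Fin d) : ℝ≥0) ^ (1 / p).toReal
  refine ⟨K, fun M x => ?_⟩
  have hM : (0 : ℝ) < M + 1 := by positivity
  have h : dist (gridRound M x) x ≤ 1 / (M + 1) := by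
    rw [dist_pi_le_iff (by positivity)]
    intro i
    have h1 := Int.floor_le ((M + 1 : ℝ) * x i)
    have h2 := Int.lt_floor_add_one ((M + 1 : ℝ) * x i)
    have he : gridRound M x i - x i
        = ((⌊(M + 1 : ℝ) * x i⌋ : ℝ) - (M + 1) * x i) / (M + 1) := by
      simp only [gridRound]
      field_simp
    rw [Real.dist_eq, he, abs_div, abs_of_pos hM]
    gcongr
    rw [abs_le]
    constructor <;> linarith
  calc _ ≤ K * dist (gridRound M x) x := hL.dist_le_mul _ _
    _ ≤ K * (1 / (M + 1)) := by gcongr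
    _ = K / (M + 1) := by ring

end Rounding

/-! ### Avoidance probabilities determine the expectation of `N`. -/

/-- A random finite subset `V` of the unit cube whose avoidance events are measurable, `v B` being
the probability that `V` has no point in `B`. -/
structure HasVoidLaw {Ω : Type*} [MeasurableSpace Ω] {d : ℕ} (V : Ω → Set (Fin d → ℝ))
    (v : Set (Fin d → ℝ) → ℝ≥0∞) (P : Measure Ω) : Prop where
  subset : ∀ ω, V ω ⊆ Set.Icc 0 1
  finite : ∀ ω, (V ω).Finite
  measurableSet_void : ∀ B, MeasurableSet B → MeasurableSet {ω | Disjoint (V ω) B}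
  measure_void : ∀ B, MeasurableSet B → P {ω | Disjoint (V ω) B} = v B

/-- A finite measure on the subsets of a finite type is determined by the masses of the
principal lower sets. -/
lemma _root_.MeasureTheory.Measure.ext_of_Iic_of_finite {α : Type*} [Finite α] [PartialOrder α]
    [MeasurableSpace α] [DiscreteMeasurableSpace α] (μ μ' : Measure α) [IsFiniteMeasure μ]
    (h : ∀ a, μ (Set.Iic a) = μ' (Set.Iic a)) : μ = μ' := by
  have hfin := Fintype.ofFinite α
  have hs : ∀ a, μ {a} = μ' {a} := by
    intro a
    -- `μ {a}` is `μ (Iic a)` minus the masses of the points strictly below `a`; finiteness of `μ`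
    -- allows the cancellation.
    induction a using WellFoundedLT.induction with
    | ind a ih =>
      have hIio : μ (Set.Iio a) = μ' (Set.Iio a) := by
        have hc : (Set.Iio a).Finite := Set.toFinite _
        have hU : Set.Iio a = ⋃ b ∈ hc.toFinset, {b} := by ext; simp
        have hd : (hc.toFinset : Set α).PairwiseDisjoint fun b => ({b} : Set α) :=
          fun x _ y _ hxy => Set.disjoint_singleton.2 hxy
        rw [hU, measure_biUnion_finset hd fun _ _ => .of_discrete,
          measure_biUnion_finset hd fun _ _ => .of_discrete]
        exact Finset.sum_congr rfl fun b hb => ih b (by simpa using hb)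
      have hd : Disjoint (Set.Iio a) {a} := by simp
      have h' := h a
      rw [← Set.Iio_union_right, measure_union hd .of_discrete, measure_union hd .of_discrete,
        ← hIio] at h'
      exact (ENNReal.add_right_inj (measure_ne_top _ _)).1 h'
  exact Measure.ext_of_singleton hs

namespace HasVoidLaw

variable {p : ℝ≥0∞} [Fact (1 ≤ p)] {d : ℕ} {Ω : Type*} [MeasurableSpace Ω]
  {V : Ω → Set (Fin d → ℝ)} {v : Set (Fin d → ℝ) → ℝ≥0∞} {P : Measure Ω}
  {Ω' : Type*} [MeasurableSpace Ω'] {V' : Ω' → Set (Fin d → ℝ)} {P' : Measure Ω'}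

/-- The random set of occupied values of `q`, as a subset of a finite set `D` of values. -/
def occupied (q : (Fin d → ℝ) → (Fin d → ℝ)) (D : Set (Fin d → ℝ)) (V : Ω → Set (Fin d → ℝ))
    (ω : Ω) : Set D :=
  {c | (c : Fin d → ℝ) ∈ q '' V ω}

lemma image_occupied {q : (Fin d → ℝ) → (Fin d → ℝ)} (hV : HasVoidLaw V v P) (ω : Ω) :
    Subtype.val '' occupied q (q '' Set.Icc 0 1) V ω = q '' V ω := by
  ext y
  constructor
  · rintro ⟨c, hc, rfl⟩
    exact hc
  · intro hy
    exact ⟨⟨y, Set.image_mono (hV.subset ω) hy⟩, hy, rfl⟩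

lemma measurable_occupied {q : (Fin d → ℝ) → (Fin d → ℝ)} (hV : HasVoidLaw V v P)
    (hq : Measurable q) (D : Set (Fin d → ℝ)) : Measurable (occupied q D V) := by
  rw [measurable_set_iff]
  intro c
  refine measurableSet_setOfPred.1 ?_
  have : {ω | c ∈ occupied q D V ω} = {ω | Disjoint (V ω) (q ⁻¹' {(c : Fin d → ℝ)})}ᶜ := by
    ext ω
    simp [occupied, Set.disjoint_left]
  rw [this]
  exact (hV.measurableSet_void _ (hq (measurableSet_singleton _))).compl

/-- The occupied values all lie in `T` exactly when `V` avoids the cells of the other values, so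
this is an avoidance probability. -/
lemma map_occupied_Iic {q : (Fin d → ℝ) → (Fin d → ℝ)}
    (hV : HasVoidLaw V v P) (hq : Measurable q) (hD : (q '' Set.Icc 0 1).Finite)
    (T : Set (q '' Set.Icc 0 1)) :
    P.map (occupied q (q '' Set.Icc 0 1) V) (Set.Iic T) = v (q ⁻¹' (Subtype.val '' Tᶜ)) := by
  have : Finite (q '' Set.Icc 0 1) := hD
  have hm : MeasurableSet (q ⁻¹' (Subtype.val '' Tᶜ)) :=
    hq (((Set.toFinite (Tᶜ)).image _).measurableSet)
  rw [Measure.map_apply (hV.measurable_occupied hq _) .of_discrete, ← hV.measure_void _ hm]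
  congr 1
  ext ω
  simp only [Set.mem_preimage, Set.mem_Iic, Set.mem_ofPred_eq, Set.disjoint_left]
  constructor
  · rintro h x hx ⟨c, hc, hcx⟩
    exact hc (h ⟨x, hx, hcx.symm⟩)
  · rintro h c ⟨x, hx, hcx⟩
    by_contra hc
    exact h hx ⟨c, hc, hcx.symm⟩

lemma map_occupied_eq [IsProbabilityMeasure P] {q : (Fin d → ℝ) → (Fin d → ℝ)}
    (hV : HasVoidLaw V v P) (hV' : HasVoidLaw V' v P') (hq : Measurable q)
    (hD : (q '' Set.Icc 0 1).Finite) :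
    P.map (occupied q (q '' Set.Icc 0 1) V) = P'.map (occupied q (q '' Set.Icc 0 1) V') := by
  have : Finite (q '' Set.Icc 0 1) := hD
  have := Measure.isProbabilityMeasure_map (μ := P)
    (hV.measurable_occupied hq (q '' Set.Icc 0 1)).aemeasurable
  refine Measure.ext_of_Iic_of_finite _ _ fun T => ?_
  rw [map_occupied_Iic hV hq hD, map_occupied_Iic hV' hq hD]

/-- No regularity of `φ` is needed, since `q '' V ω` takes finitely many values. -/
lemma measurable_comp_image (hV : HasVoidLaw V v P) {q : (Fin d → ℝ) → (Fin d → ℝ)}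
    (hq : Measurable q) (hD : (q '' Set.Icc 0 1).Finite) (φ : Set (Fin d → ℝ) → ℝ) :
    Measurable fun ω => φ (q '' V ω) := by
  have : Finite (q '' Set.Icc 0 1) := hD
  simp_rw [← hV.image_occupied]
  exact (Measurable.of_discrete (f := fun S : Set (q '' Set.Icc 0 1) =>
    φ (Subtype.val '' S))).comp (hV.measurable_occupied hq _)

lemma integral_comp_image_eq [IsProbabilityMeasure P] (hV : HasVoidLaw V v P)
    (hV' : HasVoidLaw V' v P') {q : (Fin d → ℝ) → (Fin d → ℝ)}
    (hq : Measurable q) (hD : (q '' Set.Icc 0 1).Finite) (φ : Set (Fin d → ℝ) → ℝ) :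
    ∫ ω, φ (q '' V ω) ∂P = ∫ ω, φ (q '' V' ω) ∂P' := by
  have : Finite (q '' Set.Icc 0 1) := hD
  have hm := Measurable.of_discrete (f := fun S : Set (q '' Set.Icc 0 1) => φ (Subtype.val '' S))
  simp_rw [← hV.image_occupied, ← hV'.image_occupied]
  rw [← integral_map (f := fun S : Set (q '' Set.Icc 0 1) => φ (Subtype.val '' S))
      (hV.measurable_occupied hq _).aemeasurable hm.aestronglyMeasurable,
    ← integral_map (f := fun S : Set (q '' Set.Icc 0 1) => φ (Subtype.val '' S))
      (hV'.measurable_occupied hq _).aemeasurable hm.aestronglyMeasurable,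
    map_occupied_eq hV hV' hq hD]

lemma tendsto_N_gridRound (hV : HasVoidLaw V v P) {C : ℝ}
    (hC : ∀ (M : ℕ) (x : Fin d → ℝ),
      dist (WithLp.toLp p (gridRound M x)) (WithLp.toLp p x) ≤ C / (M + 1)) (k : ℕ) (r : ℝ)
    (ω : Ω) :
    Tendsto (fun M : ℕ => (N p k (r + 2 * (C / (M + 1))) (gridRound M '' V ω) : ℝ)) atTop
      (𝓝 (N p k r (V ω))) := by
  refine tendsto_const_nhds.congr' ?_
  have hδ : Tendsto (fun M : ℕ => C / ((M : ℝ) + 1)) atTop (𝓝 0) :=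
    tendsto_const_div_atTop_nhds_zero_nat C |>.comp (tendsto_add_atTop_nat 1) |>.congr fun M => by
      simp
  filter_upwards [eventually_N_image_eq (k := k) (r := r) (hV.finite ω) hδ hC] with M hM
  rw [hM]

lemma measurable_N (hV : HasVoidLaw V v P) (k : ℕ) (r : ℝ) :
    Measurable fun ω => (N p k r (V ω) : ℝ) := by
  obtain ⟨C, hC⟩ := dist_gridRound_le p d
  exact measurable_of_tendsto_metrizable
    (fun M => hV.measurable_comp_image (measurable_gridRound M) (finite_gridRound_image M)
      fun A => N p k (r + 2 * (C / (M + 1))) A)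
    (tendsto_pi_nhds.2 fun ω => hV.tendsto_N_gridRound hC k r ω)

lemma integrable_N (hV : HasVoidLaw V v P) {g : Ω → ℝ} (hg : Integrable g P)
    (hVg : ∀ ω, ((V ω).ncard : ℝ) ≤ g ω) (k : ℕ) (r : ℝ) :
    Integrable (fun ω => (N p k r (V ω) : ℝ)) P := by
  refine hg.mono' (hV.measurable_N k r).aestronglyMeasurable (ae_of_all _ fun ω => ?_)
  rw [Real.norm_of_nonneg (Nat.cast_nonneg _)]
  exact (Nat.cast_le.2 (N_le_ncard (hV.finite ω))).trans (hVg ω)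

lemma tendsto_integral_N_gridRound (hV : HasVoidLaw V v P) {g : Ω → ℝ} (hg : Integrable g P)
    (hVg : ∀ ω, ((V ω).ncard : ℝ) ≤ g ω) {C : ℝ}
    (hC : ∀ (M : ℕ) (x : Fin d → ℝ),
      dist (WithLp.toLp p (gridRound M x)) (WithLp.toLp p x) ≤ C / (M + 1)) (k : ℕ) (r : ℝ) :
    Tendsto (fun M : ℕ => ∫ ω, (N p k (r + 2 * (C / (M + 1))) (gridRound M '' V ω) : ℝ) ∂P)
      atTop (𝓝 (∫ ω, (N p k r (V ω) : ℝ) ∂P)) := by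
  refine tendsto_integral_of_dominated_convergence g (fun M => ?_) hg (fun M => ?_) ?_
  · exact (hV.measurable_comp_image (measurable_gridRound M) (finite_gridRound_image M)
      fun A => N p k (r + 2 * (C / (M + 1))) A).aestronglyMeasurable
  · refine ae_of_all _ fun ω => ?_
    rw [Real.norm_of_nonneg (Nat.cast_nonneg _)]
    refine le_trans (Nat.cast_le.2 ?_) (hVg ω)
    exact (N_le_ncard ((hV.finite ω).image _)).trans (Set.ncard_image_le (hV.finite ω))
  · exact ae_of_all _ fun ω => hV.tendsto_N_gridRound hC k r ω

/-- The expectation of `N_{k,r}` depends only on the avoidance probabilities. -/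
lemma integral_N_eq [IsProbabilityMeasure P] (hV : HasVoidLaw V v P) (hV' : HasVoidLaw V' v P')
    {g : Ω → ℝ} (hg : Integrable g P) (hVg : ∀ ω, ((V ω).ncard : ℝ) ≤ g ω)
    {g' : Ω' → ℝ} (hg' : Integrable g' P') (hVg' : ∀ ω, ((V' ω).ncard : ℝ) ≤ g' ω)
    (k : ℕ) (r : ℝ) :
    ∫ ω, (N p k r (V ω) : ℝ) ∂P = ∫ ω, (N p k r (V' ω) : ℝ) ∂P' := by
  obtain ⟨C, hC⟩ := dist_gridRound_le p d
  refine tendsto_nhds_unique (hV.tendsto_integral_N_gridRound hg hVg hC k r)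
    ((hV'.tendsto_integral_N_gridRound hg' hVg' hC k r).congr fun M => ?_)
  exact (integral_comp_image_eq hV hV' (measurable_gridRound M) (finite_gridRound_image M)
    fun A => (N p k (r + 2 * (C / (M + 1))) A : ℝ)).symm

end HasVoidLaw

/-! ### Poisson processes on cubes: scaling, translation, subadditivity. -/

/-- The avoidance probabilities of a Poisson process of intensity `μ` in the unit cube. -/
noncomputable def poissonVoid {d : ℕ} (μ : ℝ) (B : Set (Fin d → ℝ)) : ℝ≥0∞ :=
  ENNReal.ofReal (Real.exp (-(μ * volume.real (Set.Icc 0 1 ∩ B))))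

lemma integrable_natCast_poissonMeasure (r : ℝ≥0) :
    Integrable (fun n : ℕ => (n : ℝ)) (poissonMeasure r) := by
  -- Dropping the vanishing term `n = 0` lets the factor `n` cancel against `n!`, leaving an
  -- exponential series.
  rw [integrable_poissonMeasure_iff, ← summable_nat_add_iff 1]
  refine ((Real.summable_pow_div_factorial r).mul_left (Real.exp (-r) * r)).congr fun n => ?_
  rw [Real.norm_of_nonneg (Nat.cast_nonneg _), Nat.factorial_succ]
  push_cast
  field_simp
  ring

/-- The affine map `x ↦ s⁻¹ • (x - z)` takes this box to the unit cube. -/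
lemma preimage_sub_smul_Icc {d : ℕ} {s : ℝ} (hs : 0 < s) (z : Fin d → ℝ) :
    (fun x => s⁻¹ • (x - z)) ⁻¹' Set.Icc 0 1 = Set.Icc z (z + fun _ => s) := by
  ext x
  simp only [Set.mem_preimage, Set.mem_Icc, Pi.le_def, Pi.smul_apply, Pi.sub_apply, Pi.zero_apply,
    Pi.one_apply, Pi.add_apply, smul_eq_mul, inv_mul_le_one₀ hs,
    mul_nonneg_iff_of_pos_left (inv_pos.2 hs), sub_nonneg, sub_le_iff_le_add']

lemma volume_real_preimage_sub_smul {d : ℕ} {s : ℝ} (hs : 0 < s) (z : Fin d → ℝ)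
    (B : Set (Fin d → ℝ)) :
    volume.real ((fun x => s⁻¹ • (x - z)) ⁻¹' B) = s ^ d * volume.real B := by
  have h : (fun x : Fin d → ℝ => s⁻¹ • (x - z)) ⁻¹' B
      = (fun x => x + -z) ⁻¹' ((fun x => s⁻¹ • x) ⁻¹' B) := by
    simp only [sub_eq_add_neg]
    rfl
  rw [h, measureReal_def, measure_preimage_add_right,
    Measure.addHaar_preimage_smul volume (inv_pos.2 hs).ne', ENNReal.toReal_mul,
    Module.finrank_fin_fun, inv_pow, inv_inv, abs_of_pos (by positivity),
    ENNReal.toReal_ofReal (by positivity), measureReal_def]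

namespace IsPoissonProcess

variable {p : ℝ≥0∞} [Fact (1 ≤ p)] {d k : ℕ} {ν : ℝ} {Ω : Type*} [MeasurableSpace Ω]
  {P : Measure Ω} {X : Ω → Set (Fin d → ℝ)}

lemma integrable_count (hX : IsPoissonProcess ν X P) {B : Set (Fin d → ℝ)} (hB : MeasurableSet B)
    (hb : Bornology.IsBounded B) : Integrable (fun ω => ((X ω ∩ B).ncard : ℝ)) P := by
  have h := integrable_natCast_poissonMeasure (ν * volume.real B).toNNReal
  rw [← hX.map_count B hB hb] at h
  exact h.comp_measurable (hX.measurable_count B hB hb)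

/-- Avoiding `B` after rescaling means a zero count in the preimage of `B`, whose volume is
multiplied by `s ^ d`; a Poisson variable vanishes with probability `exp (-mean)`. -/
lemma hasVoidLaw (hX : IsPoissonProcess ν X P) (hν : 0 < ν) {s : ℝ} (hs : 0 < s)
    (z : Fin d → ℝ) :
    HasVoidLaw (fun ω => (fun x => s⁻¹ • (x - z)) '' (X ω ∩ Set.Icc z (z + fun _ => s)))
      (poissonVoid (ν * s ^ d)) P := by
  have hbd (B : Set (Fin d → ℝ)) : Bornology.IsBounded
      (Set.Icc z (z + fun _ => s) ∩ (fun x => s⁻¹ • (x - z)) ⁻¹' B) :=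
    (Metric.isBounded_Icc _ _).subset Set.inter_subset_left
  have hmeas {B : Set (Fin d → ℝ)} (hB : MeasurableSet B) : MeasurableSet
      (Set.Icc z (z + fun _ => s) ∩ (fun x => s⁻¹ • (x - z)) ⁻¹' B) :=
    measurableSet_Icc.inter
      ((show Measurable fun x : Fin d → ℝ => s⁻¹ • (x - z) by fun_prop) hB)
  have hev (B : Set (Fin d → ℝ)) :
      {ω | Disjoint ((fun x => s⁻¹ • (x - z)) '' (X ω ∩ Set.Icc z (z + fun _ => s))) B}
      = (fun ω => (X ω ∩ (Set.Icc z (z + fun _ => s) ∩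
          (fun x => s⁻¹ • (x - z)) ⁻¹' B)).ncard) ⁻¹' {0} := by
    ext ω
    simp only [Set.mem_ofPred_eq, Set.mem_preimage, Set.mem_singleton_iff]
    rw [Set.ncard_eq_zero (hX.locallyFinite ω _ (hbd B)), Set.disjoint_image_left,
      ← Set.inter_assoc, Set.disjoint_iff_inter_eq_empty]
  refine ⟨fun ω => ?_, fun ω => (hX.locallyFinite ω _ (Metric.isBounded_Icc _ _)).image _,
    fun B hB => ?_, fun B hB => ?_⟩
  · rw [Set.image_subset_iff, preimage_sub_smul_Icc hs]
    exact Set.inter_subset_right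
  · rw [hev]
    exact hX.measurable_count _ (hmeas hB) (hbd B) (measurableSet_singleton 0)
  · rw [hev, ← Measure.map_apply (hX.measurable_count _ (hmeas hB) (hbd B))
      (measurableSet_singleton 0), hX.map_count _ (hmeas hB) (hbd B), poissonMeasure_singleton,
      ← preimage_sub_smul_Icc hs z, ← Set.preimage_inter, volume_real_preimage_sub_smul hs,
      Real.coe_toNNReal _ (by positivity), poissonVoid]
    simp [mul_assoc]

variable (p k)

lemma integrable_N_box (hX : IsPoissonProcess ν X P) (hν : 0 < ν) {s : ℝ} (hs : 0 < s)
    (z : Fin d → ℝ) :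
    Integrable (fun ω => (N p k 1 (X ω ∩ Set.Icc z (z + fun _ => s)) : ℝ)) P := by
  have hfin (ω : Ω) : (X ω ∩ Set.Icc z (z + fun _ => s)).Finite :=
    hX.locallyFinite ω _ (Metric.isBounded_Icc _ _)
  simp_rw [← N_image_sub_smul (hfin _) hs z]
  exact (hX.hasVoidLaw hν hs z).integrable_N
    (hX.integrable_count measurableSet_Icc (Metric.isBounded_Icc z (z + fun _ => s)))
    (fun ω => Nat.cast_le.2 (Set.ncard_image_le (hfin ω))) k s⁻¹

/-- The expectation of `N_{k,1}` over a cube of side `s`, through any random set with the same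
avoidance probabilities as the rescaled process. -/
lemma integral_N_box [IsProbabilityMeasure P] (hX : IsPoissonProcess ν X P) (hν : 0 < ν) {s : ℝ}
    (hs : 0 < s) (z : Fin d → ℝ) {Ω' : Type*} [MeasurableSpace Ω'] {P' : Measure Ω'}
    {V : Ω' → Set (Fin d → ℝ)} (hV : HasVoidLaw V (poissonVoid (ν * s ^ d)) P') {g : Ω' → ℝ}
    (hg : Integrable g P') (hVg : ∀ ω, ((V ω).ncard : ℝ) ≤ g ω) :
    ∫ ω, (N p k 1 (X ω ∩ Set.Icc z (z + fun _ => s)) : ℝ) ∂P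
      = ∫ ω, (N p k s⁻¹ (V ω) : ℝ) ∂P' := by
  have hfin (ω : Ω) : (X ω ∩ Set.Icc z (z + fun _ => s)).Finite :=
    hX.locallyFinite ω _ (Metric.isBounded_Icc _ _)
  simp_rw [← N_image_sub_smul (hfin _) hs z]
  exact (hX.hasVoidLaw hν hs z).integral_N_eq hV
    (hX.integrable_count measurableSet_Icc (Metric.isBounded_Icc z (z + fun _ => s)))
    (fun ω => Nat.cast_le.2 (Set.ncard_image_le (hfin ω))) hg hVg k s⁻¹

variable {p k} in
lemma _root_.RandomGeometricGraph.F_eq {Ω : Type*} {X : Ω → Set (Fin d → ℝ)} (t : ℝ) (ω : Ω) :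
    F p k X t ω = N p k 1 (X ω ∩ Set.Icc 0 ((0 : Fin d → ℝ) + fun _ => t)) := by
  rw [F, Set.inter_comm, zero_add]

lemma integrable_F (hX : IsPoissonProcess ν X P) (hν : 0 < ν) {t : ℝ} (ht : 0 < t) :
    Integrable (F p k X t) P := by
  simp_rw [funext (F_eq (p := p) (k := k) (X := X) t)]
  exact hX.integrable_N_box p k hν ht 0

/-- Translation invariance: both cubes rescale to random sets with the same avoidance probabilities.
-/
lemma integral_F_eq [IsProbabilityMeasure P] (hX : IsPoissonProcess ν X P) (hν : 0 < ν) {t : ℝ}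
    (ht : 0 < t) (z : Fin d → ℝ) :
    ∫ ω, (N p k 1 (X ω ∩ Set.Icc z (z + fun _ => t)) : ℝ) ∂P = ∫ ω, F p k X t ω ∂P := by
  have hfin (ω : Ω) : (X ω ∩ Set.Icc 0 ((0 : Fin d → ℝ) + fun _ => t)).Finite :=
    hX.locallyFinite ω _ (Metric.isBounded_Icc _ _)
  simp_rw [F_eq]
  rw [hX.integral_N_box p k hν ht z (hX.hasVoidLaw hν ht 0)
      (hX.integrable_count measurableSet_Icc (Metric.isBounded_Icc _ _))
      (fun ω => Nat.cast_le.2 (Set.ncard_image_le (hfin ω)))]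
  simp_rw [N_image_sub_smul (hfin _) ht 0]

lemma integral_F_mono (hX : IsPoissonProcess ν X P) (hν : 0 < ν) {s t : ℝ}
    (hs : 0 < s) (hst : s ≤ t) : ∫ ω, F p k X s ω ∂P ≤ ∫ ω, F p k X t ω ∂P := by
  refine integral_mono (hX.integrable_F p k hν hs) (hX.integrable_F p k hν (hs.trans_le hst))
    fun ω => ?_
  rw [F_eq, F_eq]
  refine Nat.cast_le.2 (N_mono (hX.locallyFinite ω _ (Metric.isBounded_Icc _ _)) ?_)
  exact Set.inter_subset_inter_right _ (Set.Icc_subset_Icc_right (by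
    intro i
    simpa using hst))

lemma _root_.RandomGeometricGraph.Icc_subset_iUnion_Icc {d m : ℕ} (hm : 0 < m) {t : ℝ}
    (ht : 0 < t) :
    Set.Icc 0 ((0 : Fin d → ℝ) + fun _ => m * t) ⊆
      ⋃ j ∈ (Finset.univ : Finset (Fin d → Fin m)),
        Set.Icc (fun i => (j i : ℝ) * t) ((fun i => (j i : ℝ) * t) + fun _ => t) := by
  intro x hx
  have h0 (i : Fin d) : 0 ≤ x i := hx.1 i
  have h1 (i : Fin d) : x i ≤ m * t := by simpa using hx.2 i
  have hj (i : Fin d) : ∃ j : Fin m, (j : ℝ) * t ≤ x i ∧ x i ≤ j * t + t := by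
    rcases (h1 i).lt_or_eq with h | h
    · have hf : ⌊x i / t⌋₊ < m := by
        rw [Nat.floor_lt (div_nonneg (h0 i) ht.le), div_lt_iff₀ ht]
        exact h
      refine ⟨⟨_, hf⟩, ?_, ?_⟩
      · rw [← le_div_iff₀ ht]
        exact Nat.floor_le (div_nonneg (h0 i) ht.le)
      · have := (Nat.lt_floor_add_one (x i / t)).le
        rw [div_le_iff₀ ht] at this
        linarith
    -- On the far face `x i = m * t` the floor would be `m`, so the last cube is used.
    · refine ⟨⟨m - 1, by omega⟩, ?_, ?_⟩ <;> simp only [Nat.cast_pred hm, h] <;> nlinarith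
  choose j hj using hj
  simp only [Finset.mem_univ, Set.iUnion_true, Set.mem_iUnion]
  exact ⟨j, fun i => (hj i).1, fun i => (hj i).2⟩

lemma integral_F_mul_le [IsProbabilityMeasure P] (hX : IsPoissonProcess ν X P) (hν : 0 < ν)
    {m : ℕ} (hm : 0 < m) {t : ℝ} (ht : 0 < t) :
    ∫ ω, F p k X (m * t) ω ∂P ≤ m ^ d * ∫ ω, F p k X t ω ∂P := by
  have hbox (j : Fin d → Fin m) := hX.integral_F_eq p k hν ht fun i => (j i : ℝ) * t
  calc ∫ ω, F p k X (m * t) ω ∂P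
      ≤ ∫ ω, ∑ j : Fin d → Fin m, (N p k 1 (X ω ∩ Set.Icc (fun i => (j i : ℝ) * t)
          ((fun i => (j i : ℝ) * t) + fun _ => t)) : ℝ) ∂P := by
        refine integral_mono (hX.integrable_F p k hν (by positivity))
          (integrable_finsetSum _ fun j _ => hX.integrable_N_box p k hν ht _) fun ω => ?_
        have hfin (j : Fin d → Fin m) : (X ω ∩ Set.Icc (fun i => (j i : ℝ) * t)
            ((fun i => (j i : ℝ) * t) + fun _ => t)).Finite :=
          hX.locallyFinite ω _ (Metric.isBounded_Icc _ _)
        simp only [F_eq]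
        norm_cast
        refine le_trans (N_mono (Set.Finite.biUnion Finset.univ.finite_toSet fun j _ => hfin j) ?_)
          (N_biUnion_le Finset.univ _ fun j _ => hfin j)
        intro x hx
        have := Icc_subset_iUnion_Icc hm ht hx.2
        simp only [Finset.coe_univ, Set.mem_univ, Finset.mem_univ, Set.iUnion_true,
          Set.mem_iUnion] at this ⊢
        obtain ⟨j, hj⟩ := this
        exact ⟨j, hx.1, hj⟩
    _ = m ^ d * ∫ ω, F p k X t ω ∂P := by
        rw [integral_finsetSum _ fun j _ => hX.integrable_N_box p k hν ht _,
          Finset.sum_congr rfl fun j _ => hbox j]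
        simp

/-- By subadditivity, the infimum that defines `a_{k,ν}` is a limit. -/
lemma tendsto_integral_F_div [IsProbabilityMeasure P] (hX : IsPoissonProcess ν X P) (hν : 0 < ν) :
    Tendsto (fun t : ℝ => (∫ ω, F p k X t ω ∂P) / (ν * t ^ d)) atTop (𝓝 (a p k ν X P)) := by
  have hnn (t : ℝ) : 0 ≤ ∫ ω, F p k X t ω ∂P := integral_nonneg fun ω => Nat.cast_nonneg _
  have hbdd : BddBelow (Set.range fun t : Set.Ioi (0 : ℝ) =>
      (∫ ω, F p k X (t : ℝ) ω ∂P) / (ν * (t : ℝ) ^ d)) := by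
    refine ⟨0, ?_⟩
    rintro _ ⟨⟨t, ht⟩, rfl⟩
    have ht : 0 < t := ht
    exact div_nonneg (hnn t) (by positivity)
  rw [tendsto_order]
  constructor
  · intro l hl
    filter_upwards [eventually_gt_atTop 0] with t ht
    exact hl.trans_le (ciInf_le hbdd ⟨t, ht⟩)
  · intro u hu
    -- Fix a side `t` whose ratio is below `u`. A cube of side `s` is covered by `⌈s / t⌉₊ ^ d`
    -- cubes of side `t`, and the loss from rounding `s / t` up disappears as `s → ∞`.
    obtain ⟨⟨t, ht⟩, htu⟩ := exists_lt_of_ciInf_lt hu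
    have ht : 0 < t := ht
    have hceil : Tendsto (fun s : ℝ => (⌈s / t⌉₊ : ℝ) / (s / t)) atTop (𝓝 1) :=
      (tendsto_nat_ceil_div_atTop (R := ℝ)).comp (tendsto_id.atTop_div_const ht)
    have hlim := (hceil.pow d).mul_const ((∫ ω, F p k X t ω ∂P) / (ν * t ^ d))
    rw [one_pow, one_mul] at hlim
    filter_upwards [hlim.eventually_lt_const htu, eventually_gt_atTop 0] with s hs hs0
    refine lt_of_le_of_lt ?_ hs
    have hst : 0 < s / t := by positivity
    have hle : s ≤ ⌈s / t⌉₊ * t := by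
      rw [← div_le_iff₀ ht]
      exact Nat.le_ceil _
    calc (∫ ω, F p k X s ω ∂P) / (ν * s ^ d)
        ≤ (⌈s / t⌉₊ ^ d * ∫ ω, F p k X t ω ∂P) / (ν * s ^ d) := by
          gcongr
          exact (hX.integral_F_mono p k hν hs0 hle).trans
            (hX.integral_F_mul_le p k hν (Nat.ceil_pos.2 hst) ht)
      _ = _ := by
          rw [div_pow, div_pow]
          field_simp

end IsPoissonProcess

/-! ### Moments and generating function of the Poisson distribution. -/

section PoissonMoments

/-- This is the identity `E[m f(m)] = r E[f(m + 1)]`; applying it repeatedly yields the moments. -/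
lemma hasSum_poisson_mul {r S : ℝ} {f : ℕ → ℝ}
    (h : HasSum (fun m : ℕ => Real.exp (-r) * r ^ m / m.factorial * f (m + 1)) S) :
    HasSum (fun m : ℕ => Real.exp (-r) * r ^ m / m.factorial * (m * f m)) (r * S) := by
  rw [← hasSum_nat_add_iff' 1]
  simp only [Finset.sum_range_one, Nat.cast_zero, zero_mul, mul_zero, sub_zero]
  refine (h.mul_left r).congr_fun fun m => ?_
  rw [Nat.factorial_succ]
  push_cast
  field_simp
  ring

lemma hasSum_poisson_id (r : ℝ≥0) :
    HasSum (fun m : ℕ => Real.exp (-r) * (r : ℝ) ^ m / m.factorial * m) r := by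
  have h := hasSum_poisson_mul (f := fun _ => 1) (by simpa using hasSum_one_poissonMeasure r)
  simpa using h

lemma hasSum_poisson_sq (r : ℝ≥0) :
    HasSum (fun m : ℕ => Real.exp (-r) * (r : ℝ) ^ m / m.factorial * (m : ℝ) ^ 2)
      (r * (r + 1)) := by
  have h := hasSum_poisson_mul (r := r) (S := r + 1) (f := fun m => (m : ℝ)) (by
    have := (hasSum_poisson_id r).add (hasSum_one_poissonMeasure r)
    refine this.congr_fun fun m => ?_
    push_cast
    ring)
  simpa only [sq] using h

lemma hasSum_poisson_variance (r : ℝ≥0) :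
    HasSum (fun m : ℕ => Real.exp (-r) * (r : ℝ) ^ m / m.factorial * ((m : ℝ) - r) ^ 2) r := by
  have h := ((hasSum_poisson_sq r).sub ((hasSum_poisson_id r).mul_left (2 * (r : ℝ)))).add
    ((hasSum_one_poissonMeasure r).mul_left ((r : ℝ) ^ 2))
  have hr : (r * (r + 1) - 2 * r * r + r ^ 2 * 1 : ℝ) = r := by ring
  rw [hr] at h
  refine h.congr_fun fun m => ?_
  ring

lemma integrable_sq_poissonMeasure (r : ℝ≥0) :
    Integrable (fun m : ℕ => ((m : ℝ) - r) ^ 2) (poissonMeasure r) := by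
  rw [integrable_poissonMeasure_iff]
  refine (hasSum_poisson_variance r).summable.congr fun m => ?_
  rw [Real.norm_of_nonneg (sq_nonneg _)]

/-- The mean absolute deviation of a Poisson variable is at most its standard deviation. -/
lemma integral_abs_sub_poissonMeasure_le {r : ℝ≥0} (hr : 0 < r) :
    ∫ m : ℕ, |(m : ℝ) - r| ∂poissonMeasure r ≤ √r := by
  have hr' : (0 : ℝ) < r := hr
  have hs : 0 < √(r : ℝ) := Real.sqrt_pos.2 hr'
  have hint := integrable_sq_poissonMeasure r
  calc ∫ m : ℕ, |(m : ℝ) - r| ∂poissonMeasure r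
      -- Pointwise AM–GM, `2 |m - r| √r ≤ (m - r)² + r`, weighted so that each of the two terms
      -- integrates to `√r / 2`.
      ≤ ∫ m : ℕ, (((m : ℝ) - r) ^ 2 * (2 * √r)⁻¹ + √r / 2) ∂poissonMeasure r := by
        refine integral_mono (((integrable_natCast_poissonMeasure r).sub
          (integrable_const _)).abs) ((hint.mul_const _).add (integrable_const _)) fun m => ?_
        have h := two_mul_le_add_sq |(m : ℝ) - r| √r
        rw [sq_abs] at h
        have he : ((m : ℝ) - r) ^ 2 * (2 * √r)⁻¹ + √r / 2
            = (((m : ℝ) - r) ^ 2 + √(r : ℝ) ^ 2) / (2 * √r) := by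
          field_simp
        show |(m : ℝ) - r| ≤ ((m : ℝ) - r) ^ 2 * (2 * √r)⁻¹ + √r / 2
        rw [he, le_div_iff₀ (by positivity)]
        linarith
    _ = √r := by
        rw [integral_add (hint.mul_const _) (integrable_const _), integral_mul_const,
          integral_poissonMeasure]
        simp only [smul_eq_mul, (hasSum_poisson_variance r).tsum_eq, integral_const, probReal_univ,
          one_mul]
        field_simp
        rw [Real.sq_sqrt hr'.le]
        ring

lemma integral_pow_poissonMeasure (r : ℝ≥0) (x : ℝ) :
    ∫ m : ℕ, x ^ m ∂poissonMeasure r = Real.exp (-(r * (1 - x))) := by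
  rw [integral_poissonMeasure]
  have h := (NormedSpace.expSeries_div_hasSum_exp (r * x : ℝ)).mul_left (Real.exp (-r))
  rw [← Real.exp_eq_exp_ℝ, ← Real.exp_add] at h
  rw [show (-(r * (1 - x)) : ℝ) = -r + r * x by ring, ← h.tsum_eq]
  congr 1 with m
  rw [smul_eq_mul, mul_pow]
  ring

end PoissonMoments

/-! ### Uniform samples. -/

/-- The avoidance probabilities of `m` independent uniform points of the unit cube. -/
noncomputable def uniformVoid {d : ℕ} (m : ℕ) (B : Set (Fin d → ℝ)) : ℝ≥0∞ :=
  (1 - volume (Set.Icc 0 1 ∩ B)) ^ m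

lemma volume_unitCube (d : ℕ) : volume (Set.Icc 0 1 : Set (Fin d → ℝ)) = 1 := by
  simp [Real.volume_Icc_pi]

namespace IsUniformSample

variable {p : ℝ≥0∞} [Fact (1 ≤ p)] {d k : ℕ} {r : ℝ} {Ω : Type*} [MeasurableSpace Ω]
  {Q : Measure Ω} {n : ℕ} {U : Fin n → Ω → Fin d → ℝ}

lemma measure_preimage_compl (hU : IsUniformSample U Q) (i : Fin n) {B : Set (Fin d → ℝ)}
    (hB : MeasurableSet B) : Q (U i ⁻¹' (Set.Icc 0 1 ∩ B)ᶜ) = 1 - volume (Set.Icc 0 1 ∩ B) := by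
  rw [(hU.uniform i).measure_preimage (by simp [volume_unitCube]) (by simp [volume_unitCube])
      (measurableSet_Icc.inter hB).compl, volume_unitCube, div_one, ← Set.sdiff_eq,
    measure_sdiff Set.inter_subset_left (measurableSet_Icc.inter hB).nullMeasurableSet
      (measure_ne_top_of_subset Set.inter_subset_left (by simp [volume_unitCube])),
    volume_unitCube]

lemma ae_mem_Icc (hU : IsUniformSample U Q) : ∀ᵐ ω ∂Q, ∀ i, U i ω ∈ Set.Icc 0 1 := by
  rw [ae_all_iff]
  intro i
  have h := hU.measure_preimage_compl i MeasurableSet.univ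
  rw [Set.inter_univ, volume_unitCube, tsub_self] at h
  exact h

lemma disjoint_range_iff {Ω : Type*} (U : Fin n → Ω → Fin d → ℝ) (B : Set (Fin d → ℝ)) :
    {ω | Disjoint (Set.range (fun i => U i ω) ∩ Set.Icc 0 1) B}
      = ⋂ i ∈ Finset.univ, U i ⁻¹' (Set.Icc 0 1 ∩ B)ᶜ := by
  ext ω
  simp only [Set.mem_ofPred_eq, Set.disjoint_left, Set.mem_inter_iff, Set.mem_range, Set.mem_iInter,
    Set.mem_preimage, Set.mem_compl_iff, Finset.mem_univ, true_imp_iff, not_and]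
  exact ⟨fun h i hi => h ⟨⟨i, rfl⟩, hi⟩, by rintro h _ ⟨⟨i, rfl⟩, hi⟩; exact h i hi⟩

/-- The sample lies in the cube only almost surely, while `HasVoidLaw` asks for every `ω`; hence the
intersection, which `H_ae_eq` later removes. -/
lemma hasVoidLaw (hU : IsUniformSample U Q) :
    HasVoidLaw (fun ω => Set.range (fun i => U i ω) ∩ Set.Icc 0 1) (uniformVoid n) Q := by
  refine ⟨fun ω => Set.inter_subset_right, fun ω => (Set.finite_range _).inter_of_left _,
    fun B hB => ?_, fun B hB => ?_⟩
  · rw [disjoint_range_iff]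
    exact Finset.measurableSet_biInter _ fun i _ =>
      hU.measurable i (measurableSet_Icc.inter hB).compl
  · rw [disjoint_range_iff, hU.indep.measure_inter_preimage_eq_mul _
      fun i _ => (measurableSet_Icc.inter hB).compl,
      Finset.prod_congr rfl fun i _ => hU.measure_preimage_compl i hB]
    simp [uniformVoid]

lemma ncard_range_inter_le {Ω : Type*} (U : Fin n → Ω → Fin d → ℝ) (ω : Ω) :
    ((Set.range (fun i => U i ω) ∩ Set.Icc 0 1).ncard : ℝ) ≤ n := by
  refine Nat.cast_le.2 ((Set.ncard_inter_le_ncard_left _ _ (Set.finite_range _)).trans ?_)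
  rw [← Set.image_univ]
  refine (Set.ncard_image_le Set.finite_univ).trans ?_
  simp

lemma H_ae_eq (hU : IsUniformSample U Q) :
    H p k r U =ᵐ[Q] fun ω => (N p k r (Set.range (fun i => U i ω) ∩ Set.Icc 0 1) : ℝ) := by
  filter_upwards [hU.ae_mem_Icc] with ω hω
  rw [H, Set.inter_eq_left.2]
  rintro _ ⟨i, rfl⟩
  exact hω i

variable (p k r)

lemma integrable_N [IsProbabilityMeasure Q] (hU : IsUniformSample U Q) :
    Integrable (fun ω => (N p k r (Set.range (fun i => U i ω) ∩ Set.Icc 0 1) : ℝ)) Q :=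
  hU.hasVoidLaw.integrable_N (integrable_const (n : ℝ)) (ncard_range_inter_le U) k r

lemma integrable_H [IsProbabilityMeasure Q] (hU : IsUniformSample U Q) :
    Integrable (H p k r U) Q :=
  (hU.integrable_N p k r).congr hU.H_ae_eq.symm

lemma castLE {m : ℕ} (hU : IsUniformSample U Q) (h : m ≤ n) :
    IsUniformSample (fun i : Fin m => U (Fin.castLE h i)) Q :=
  ⟨fun _ => hU.measurable _, fun _ => hU.uniform _,
    hU.indep.precomp (Fin.castLE_injective h)⟩

lemma integral_H_eq [IsProbabilityMeasure Q] (hU : IsUniformSample U Q) {Ω' : Type*}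
    [MeasurableSpace Ω'] {Q' : Measure Ω'} [IsProbabilityMeasure Q'] {U' : Fin n → Ω' → Fin d → ℝ}
    (hU' : IsUniformSample U' Q') : ∫ ω, H p k r U ω ∂Q = ∫ ω, H p k r U' ω ∂Q' := by
  rw [integral_congr_ae hU.H_ae_eq, integral_congr_ae hU'.H_ae_eq]
  exact hU.hasVoidLaw.integral_N_eq hU'.hasVoidLaw (integrable_const (n : ℝ))
    (ncard_range_inter_le U) (integrable_const (n : ℝ)) (ncard_range_inter_le U') k r

/-- No coupling between `U` and `U'` is assumed. Only the law matters, so `U'` is replaced by the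
first `m` points of `U`; the other `n - m` points add at most `n - m` to `N`. -/
lemma abs_integral_H_sub_le_of_le [IsProbabilityMeasure Q] {m : ℕ} (h : m ≤ n)
    (hU : IsUniformSample U Q) {U' : Fin m → Ω → Fin d → ℝ} (hU' : IsUniformSample U' Q) :
    |∫ ω, H p k r U' ω ∂Q - ∫ ω, H p k r U ω ∂Q| ≤ |(m : ℝ) - n| := by
  rw [hU'.integral_H_eq p k r (hU.castLE h)]
  have hi := (hU.castLE h).integrable_H p k r
  have hi' := hU.integrable_H p k r
  have hsub (ω : Ω) : (Set.range fun i : Fin m => U (Fin.castLE h i) ω) ⊆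
      Set.range fun i => U i ω := by
    rintro _ ⟨i, rfl⟩
    exact ⟨_, rfl⟩
  have h1 : ∫ ω, H p k r (fun i : Fin m => U (Fin.castLE h i)) ω ∂Q ≤ ∫ ω, H p k r U ω ∂Q :=
    integral_mono hi hi' fun ω => Nat.cast_le.2 (N_mono (Set.finite_range _) (hsub ω))
  have h2 : ∫ ω, H p k r U ω ∂Q ≤
      ∫ ω, H p k r (fun i : Fin m => U (Fin.castLE h i)) ω ∂Q + (n - m : ℕ) := by
    have hc : ∫ ω, (H p k r (fun i : Fin m => U (Fin.castLE h i)) ω + (n - m : ℕ)) ∂Q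
        = ∫ ω, H p k r (fun i : Fin m => U (Fin.castLE h i)) ω ∂Q + (n - m : ℕ) := by
      rw [integral_add hi (integrable_const _)]
      simp
    rw [← hc]
    refine integral_mono hi' (hi.add (integrable_const _)) fun ω => ?_
    have hN := N_le_add_ncard_sdiff (p := p) (k := k) (r := r) (Set.finite_range _) (hsub ω)
    have hcard : ((Set.range fun i => U i ω) \
        Set.range fun i : Fin m => U (Fin.castLE h i) ω).ncard ≤ n - m := by
      have hss : ((Set.range fun i => U i ω) \ Set.range fun i : Fin m => U (Fin.castLE h i) ω) ⊆
          (fun i => U i ω) '' {i : Fin n | m ≤ i} := by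
        rintro _ ⟨⟨i, rfl⟩, hi⟩
        refine ⟨i, ?_, rfl⟩
        by_contra hlt
        exact hi ⟨⟨i, not_le.1 hlt⟩, rfl⟩
      refine (Set.ncard_le_ncard hss (Set.toFinite _)).trans
        ((Set.ncard_image_le (Set.toFinite _)).trans ?_)
      have : {i : Fin n | m ≤ i} = ((Finset.univ.filter fun i : Fin n => m ≤ i : Finset (Fin n)) :
          Set (Fin n)) := by
        ext; simp
      rw [this, Set.ncard_coe_finset]
      have hadd := Finset.card_filter_add_card_filter_not (s := (Finset.univ : Finset (Fin n)))
        (fun i => (i : ℕ) < m)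
      rw [Fin.card_filter_val_lt, Finset.card_univ, Fintype.card_fin] at hadd
      simp only [not_lt] at hadd
      omega
    simp only [H]
    exact_mod_cast hN.trans (Nat.add_le_add_left hcard _)
  rw [Nat.cast_sub h] at h2
  rw [abs_le, abs_of_nonpos (sub_nonpos.2 (Nat.cast_le.2 h))]
  constructor <;> linarith

lemma abs_integral_H_sub_le [IsProbabilityMeasure Q] {m : ℕ}
    (hU : IsUniformSample U Q) {U' : Fin m → Ω → Fin d → ℝ} (hU' : IsUniformSample U' Q) :
    |∫ ω, H p k r U' ω ∂Q - ∫ ω, H p k r U ω ∂Q| ≤ |(m : ℝ) - n| := by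
  rcases le_total m n with h | h
  · exact abs_integral_H_sub_le_of_le p k r h hU hU'
  · rw [abs_sub_comm, abs_sub_comm (m : ℝ)]
    exact abs_integral_H_sub_le_of_le p k r h hU' hU

end IsUniformSample

/-! ### Poissonization. -/

section Poissonization

variable {p : ℝ≥0∞} [Fact (1 ≤ p)] {d k : ℕ} {Ω : Type*} [MeasurableSpace Ω]
  {Q : Measure Ω} [IsProbabilityMeasure Q] {U : (n : ℕ) → Fin n → Ω → Fin d → ℝ}

/-- A Poisson number of independent uniform points has the avoidance probabilities of a Poisson
process. -/
lemma hasVoidLaw_poissonization (hU : ∀ n, IsUniformSample (U n) Q) (μ : ℝ≥0) :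
    HasVoidLaw (fun x : ℕ × Ω => Set.range (fun i => U x.1 i x.2) ∩ Set.Icc 0 1)
      (poissonVoid μ) ((poissonMeasure μ).prod Q) := by
  have hmeas (B : Set (Fin d → ℝ)) (hB : MeasurableSet B) : MeasurableSet {x : ℕ × Ω |
      Disjoint (Set.range (fun i => U x.1 i x.2) ∩ Set.Icc 0 1) B} := by
    have he : {x : ℕ × Ω | Disjoint (Set.range (fun i => U x.1 i x.2) ∩ Set.Icc 0 1) B}
        = ⋃ m : ℕ, ({m} : Set ℕ) ×ˢ
          {ω | Disjoint (Set.range (fun i => U m i ω) ∩ Set.Icc 0 1) B} := by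
      ext ⟨m, ω⟩
      simp
    rw [he]
    exact MeasurableSet.iUnion fun m =>
      (measurableSet_singleton m).prod ((hU m).hasVoidLaw.measurableSet_void B hB)
  refine ⟨fun x => Set.inter_subset_right, fun x => (Set.finite_range _).inter_of_left _, hmeas,
    fun B hB => ?_⟩
  have hle : volume.real (Set.Icc 0 1 ∩ B) ≤ 1 := by
    have := measureReal_mono (μ := volume) (Set.inter_subset_left (s := Set.Icc 0 1) (t := B))
      (by simp [volume_unitCube])
    simpa [measureReal_def, volume_unitCube] using this
  have hne : volume (Set.Icc 0 1 ∩ B) ≠ ∞ :=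
    measure_ne_top_of_subset Set.inter_subset_left (by simp [volume_unitCube])
  have hsec (m : ℕ) : Q (Prod.mk m ⁻¹' {x : ℕ × Ω |
      Disjoint (Set.range (fun i => U x.1 i x.2) ∩ Set.Icc 0 1) B})
      = ENNReal.ofReal ((1 - volume.real (Set.Icc 0 1 ∩ B)) ^ m) := by
    refine ((hU m).hasVoidLaw.measure_void B hB).trans ?_
    rw [uniformVoid, ENNReal.ofReal_pow (by linarith), ENNReal.ofReal_sub _ measureReal_nonneg,
      ENNReal.ofReal_one, measureReal_def, ENNReal.ofReal_toReal hne]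
  -- Averaging `(1 - vol) ^ m` over the Poisson number `m` of points evaluates the generating
  -- function at `1 - vol`.
  rw [Measure.prod_apply (hmeas B hB), lintegral_congr hsec,
    ← ofReal_integral_eq_lintegral_ofReal, integral_pow_poissonMeasure, poissonVoid]
  · simp
  · refine (integrable_const (1 : ℝ)).mono' .of_discrete (ae_of_all _ fun m => ?_)
    rw [Real.norm_of_nonneg (pow_nonneg (by linarith) _)]
    have h0 : 0 ≤ volume.real (Set.Icc 0 1 ∩ B) := measureReal_nonneg
    exact pow_le_one₀ (by linarith) (by linarith)
  · exact ae_of_all _ fun m => pow_nonneg (by linarith) _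

variable (p k) in
-- `E F(t)` is the Poisson(`n`) average of `E H(m)` with the radius `t⁻¹` held fixed, and replacing
-- `m` by `n` costs at most `|m - n|`.
lemma abs_integral_F_sub_integral_H_le {ν : ℝ} (hν : 0 < ν) {Ω' : Type*} [MeasurableSpace Ω']
    {P : Measure Ω'} [IsProbabilityMeasure P] {X : Ω' → Set (Fin d → ℝ)}
    (hX : IsPoissonProcess ν X P) (hU : ∀ n, IsUniformSample (U n) Q) {t : ℝ} (ht : 0 < t)
    {n : ℕ} (hn : 0 < n) (hnt : ν * t ^ d = n) :
    |∫ ω, F p k X t ω ∂P - ∫ ω, H p k t⁻¹ (U n) ω ∂Q| ≤ √n := by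
  have hV := hasVoidLaw_poissonization hU (n : ℝ≥0)
  have hn' : ((n : ℝ≥0) : ℝ) = ν * t ^ d := by rw [hnt]; simp
  have hcast : Integrable (fun x : ℕ × Ω => (x.1 : ℝ)) ((poissonMeasure (n : ℝ≥0)).prod Q) :=
    (integrable_natCast_poissonMeasure _).comp_fst Q
  have hint := hV.integrable_N (p := p) hcast
    (fun x => IsUniformSample.ncard_range_inter_le (U x.1) x.2) k t⁻¹
  have hF : ∫ ω, F p k X t ω ∂P
      = ∫ m : ℕ, (∫ ω, H p k t⁻¹ (U m) ω ∂Q) ∂poissonMeasure (n : ℝ≥0) := by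
    simp_rw [F_eq]
    rw [hX.integral_N_box p k hν ht 0 (hn' ▸ hV) hcast
      (fun x => IsUniformSample.ncard_range_inter_le (U x.1) x.2), integral_prod _ hint]
    exact integral_congr_ae (ae_of_all _ fun m => (integral_congr_ae (hU m).H_ae_eq).symm)
  have habs : Integrable (fun m : ℕ => |(m : ℝ) - (n : ℝ≥0)|) (poissonMeasure (n : ℝ≥0)) :=
    ((integrable_natCast_poissonMeasure _).sub (integrable_const _)).abs
  have hH : Integrable (fun m : ℕ => ∫ ω, H p k t⁻¹ (U m) ω ∂Q) (poissonMeasure (n : ℝ≥0)) :=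
    hint.integral_prod_left.congr
      (ae_of_all _ fun m => (integral_congr_ae (hU m).H_ae_eq).symm)
  have hsub : ∫ ω, F p k X t ω ∂P - ∫ ω, H p k t⁻¹ (U n) ω ∂Q
      = ∫ m : ℕ, (∫ ω, H p k t⁻¹ (U m) ω ∂Q - ∫ ω, H p k t⁻¹ (U n) ω ∂Q)
        ∂poissonMeasure (n : ℝ≥0) := by
    rw [hF, integral_sub hH (integrable_const _)]
    simp
  rw [hsub]
  calc _ ≤ ∫ m : ℕ, |∫ ω, H p k t⁻¹ (U m) ω ∂Q - ∫ ω, H p k t⁻¹ (U n) ω ∂Q|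
        ∂poissonMeasure (n : ℝ≥0) := abs_integral_le_integral_abs
    _ ≤ ∫ m : ℕ, |(m : ℝ) - (n : ℝ≥0)| ∂poissonMeasure (n : ℝ≥0) :=
        integral_mono (hH.sub (integrable_const _)).abs habs fun m => by
          simpa using (hU n).abs_integral_H_sub_le p k t⁻¹ (hU m)
    _ ≤ √n := by
        simpa using integral_abs_sub_poissonMeasure_le (r := (n : ℝ≥0)) (by exact_mod_cast hn)

end Poissonization

end RandomGeometricGraph

/-! ### The limit along `t = (n/ν)^(1/d)`. -/

theorem proposition3
    (p : ℝ≥0∞) [Fact (1 ≤ p)] (d : ℕ) (hd : 1 ≤ d) (k : ℕ) (hk : 1 ≤ k) (ν : ℝ) (hν : 0 < ν)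
    -- a Poisson point process of intensity `ν` in `ℝ^d`
    {Ω : Type*} [MeasurableSpace Ω] (P : Measure Ω) [IsProbabilityMeasure P]
    (X : Ω → Set (Fin d → ℝ)) (hX : RandomGeometricGraph.IsPoissonProcess ν X P)
    -- for every `n`, a sample `U n` of `n` independent uniform points of `[0, 1]^d`
    {Ω' : Type*} [MeasurableSpace Ω'] (Q : Measure Ω') [IsProbabilityMeasure Q]
    (U : (n : ℕ) → Fin n → Ω' → Fin d → ℝ)
    (hU : ∀ n, RandomGeometricGraph.IsUniformSample (U n) Q) :
    -- the expectations below exist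
    (∀ t : ℝ, 0 < t → Integrable (RandomGeometricGraph.F p k X t) P) ∧
    (∀ n : ℕ, Integrable (RandomGeometricGraph.H p k ((ν / n) ^ (1 / d : ℝ)) (U n)) Q) ∧
    -- and the expected coloured fraction converges to `a_{k,ν}`
    Tendsto
      (fun n : ℕ =>
        (∫ ω, RandomGeometricGraph.H p k ((ν / n) ^ (1 / d : ℝ)) (U n) ω ∂Q) / n)
      atTop (𝓝 (RandomGeometricGraph.a p k ν X P)) := by
  refine ⟨fun t ht => hX.integrable_F p k hν ht, fun n => (hU n).integrable_H p k _, ?_⟩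
  have ht : Tendsto (fun n : ℕ => ((n : ℝ) / ν) ^ (1 / d : ℝ)) atTop atTop :=
    (tendsto_rpow_atTop (by positivity)).comp
      (tendsto_natCast_atTop_atTop.atTop_div_const hν)
  have hF := (hX.tendsto_integral_F_div p k hν).comp ht
  have hsqrt : Tendsto (fun n : ℕ => (√(n : ℝ))⁻¹) atTop (𝓝 0) :=
    tendsto_inv_atTop_zero.comp (Real.tendsto_sqrt_atTop.comp tendsto_natCast_atTop_atTop)
  -- Along this sequence `ν t^d = n`, so the two ratios differ by at most `√n / n = 1 / √n`.
  refine hF.congr_dist (squeeze_zero' (.of_forall fun _ => dist_nonneg) ?_ hsqrt)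
  filter_upwards [eventually_gt_atTop 0] with n hn
  have hn' : (0 : ℝ) < n := Nat.cast_pos.2 hn
  have hpow : ν * (((n : ℝ) / ν) ^ (1 / d : ℝ)) ^ d = n := by
    rw [one_div, Real.rpow_inv_natCast_pow (by positivity) (by omega)]
    field_simp
  have hinv : (ν / n : ℝ) ^ (1 / d : ℝ) = (((n : ℝ) / ν) ^ (1 / d : ℝ))⁻¹ := by
    rw [← Real.inv_rpow (by positivity), inv_div]
  have h := RandomGeometricGraph.abs_integral_F_sub_integral_H_le p k hν hX hU
    (t := ((n : ℝ) / ν) ^ (1 / d : ℝ)) (by positivity) hn hpow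
  rw [Function.comp_apply, hpow, hinv, Real.dist_eq, ← sub_div, abs_div, abs_of_pos hn',
    div_le_iff₀ hn']
  refine h.trans_eq ?_
  rw [inv_mul_eq_div, Real.div_sqrt]
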